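/- Let $\Omega\subset\mathbb C^m$ be a bounded domain (a nonempty, bounded, connected open set) and let $\mathcal A=\mathcal A(\Omega)$ be the closure, in the supremum norm on $\Omega$, of the algebra of functions holomorphic in some neighbourhood of $\overline\Omega$. A Hilbert module over $\mathcal A$ is a complex Hilbert space $\mathcal M$ with a unital $\mathcal A$-module structure (extending the scalar multiplication by $\mathbb C$) whose multiplication $\mathcal A\times\mathcal M\to\mathcal M$ is continuous; module maps are bounded $\mathcal A$-linear maps. A family of vectors generates $\mathcal M$ if the $\mathcal A$-submodule it generates algebraically is dense. The module tensor product $\mathcal M\otimes_{\mathcal A}\mathcal N$ is the quotient of the Hilbert space tensor product $\mathcal M\otimes\mathcal N$ by the closed subspace spanned by the vectors $\varphi f\otimes g-f\otimes\varphi g$ ($\varphi\in\mathcal A$, $f\in\mathcal M$, $g\in\mathcal N$), and $f\otimes_{\mathcal A}g$ is the image of $f\otimes g$. For $z\in\Omega$, $\mathbb C_z$ is the Hilbert module $\mathbb C$ on which $\varphi$ acts as multiplication by $\varphi(z)$, and $1_z$ is its vector $1$. A Hilbert module $\mathcal R$ is quasi-free of rank $k$ (a cardinal number $k\ge 1$)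 relative to a generating family $(f_i)_{i\in I}$ with $|I|=k$ if (i) for every $z\in\Omega$ the vectors $f_i\otimes_{\mathcal A}1_z$ are linearly independent and their linear span is dense in $\mathcal R\otimes_{\mathcal A}\mathbb C_z$; (ii) the norms of the linear maps $X_z$ from the linear span of $\{f_i\otimes_{\mathcal A}1_z\}_{i\in I}$ to $\ell^2(I)$ with $X_z(f_i\otimes_{\mathcal A}1_z)=e_i$ are finite and locally uniformly bounded in $z\in\Omega$; (iii) for $h\in\mathcal R$, $h\otimes_{\mathcal A}1_z=0$ for all $z\in\Omega$ if and only if $h=0$. A Hilbert module $\mathcal M$ belongs to class (SM) if there is a Hilbert module $\mathcal R$ which is quasi-free of rank one relative to a vector $g$ such that the map $\mathcal M\to\mathcal M\otimes_{\mathcal A}\mathcal R$, $f\mapsto f\otimes_{\mathcal A}g$, is injective. A weak resolution of $\mathcal M$ by quasi-free Hilbert modules is a sequence of Hilbert modules and module maps $$0\longleftarrow\mathcal M\xleftarrow{X_0}\mathcal R_1\xleftarrow{X_1}\mathcal R_2\xleftarrow{X_2}\cdots$$ such that $X_0$ has dense range and $\ker X_i=\overline{\operatorname{ran}X_{i+1}}$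 for all $i\ge 0$, where either all $\mathcal R_i$ are quasi-free, or (finite length) for some $N$ the $\mathcal R_i$ with $i<N$ are quasi-free and $\mathcal R_i=0$ for all $i\ge N$. Theorem. Every Hilbert module $\mathcal M$ over $\mathcal A(\Omega)$ in class (SM) has a weak resolution by quasi-free Hilbert modules. If, moreover, $\mathcal M$ is generated by countably many vectors, then the nonzero modules of this resolution can be taken to be quasi-free of finite or countably infinite rank. -/

import Mathlib

open scoped TensorProduct BoundedContinuousFunction lp

noncomputable section

namespace QuasiFreeResolution

universe u v

section FunctionAlgebra

variable {m : ℕ}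

/-- The restrictions to `Ω` of the functions that are holomorphic in some neighbourhood of the
closure of `Ω` (and bounded on `Ω`, which is automatic for bounded `Ω`). -/
def holomorphicNearClosure (Ω : Set (Fin m → ℂ)) : Subalgebra ℂ (Ω →ᵇ ℂ) where
  carrier := {f | ∃ (U : Set (Fin m → ℂ)) (F : (Fin m → ℂ) → ℂ),
    IsOpen U ∧ closure Ω ⊆ U ∧ DifferentiableOn ℂ F U ∧ ∀ z : Ω, f z = F z}
  mul_mem' := by
    rintro f g ⟨U, F, hU, hΩU, hF, hf⟩ ⟨V, G, hV, hΩV, hG, hg⟩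
    exact ⟨U ∩ V, fun z => F z * G z, hU.inter hV, Set.subset_inter hΩU hΩV,
      (hF.mono Set.inter_subset_left).mul (hG.mono Set.inter_subset_right),
      fun z => by simp [hf z, hg z]⟩
  add_mem' := by
    rintro f g ⟨U, F, hU, hΩU, hF, hf⟩ ⟨V, G, hV, hΩV, hG, hg⟩
    exact ⟨U ∩ V, fun z => F z + G z, hU.inter hV, Set.subset_inter hΩU hΩV,
      (hF.mono Set.inter_subset_left).add (hG.mono Set.inter_subset_right),
      fun z => by simp [hf z, hg z]⟩
  algebraMap_mem' := fun c =>
    ⟨Set.univ, fun _ => c, isOpen_univ, Set.subset_univ _, differentiableOn_const c,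
      fun _ => rfl⟩

/-- The function algebra `𝒜(Ω)`: the closure in the supremum norm on `Ω` of the functions
holomorphic in some neighbourhood of the closure of `Ω`. -/
abbrev FunctionAlgebra (Ω : Set (Fin m → ℂ)) : Subalgebra ℂ (Ω →ᵇ ℂ) :=
  (holomorphicNearClosure Ω).topologicalClosure

/-- Evaluation of the functions in `𝒜(Ω)` at a point of `Ω`. -/
def evalAt {Ω : Set (Fin m → ℂ)} (z : Ω) : FunctionAlgebra Ω →+* ℂ where
  toFun φ := (φ : Ω →ᵇ ℂ) z
  map_one' := rfl
  map_mul' _ _ := rfl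
  map_zero' := rfl
  map_add' _ _ := rfl

end FunctionAlgebra

/-- A Hilbert module over `𝒜(Ω)`: a complex Hilbert space with a unital `𝒜(Ω)`-module structure,
compatible with the complex scalars, whose multiplication `𝒜(Ω) × M → M` is continuous. -/
structure HilbertModule {m : ℕ} (Ω : Set (Fin m → ℂ)) where
  /-- The underlying Hilbert space. -/
  carrier : Type u
  [normedAddCommGroup : NormedAddCommGroup carrier]
  [innerProductSpace : InnerProductSpace ℂ carrier]
  [completeSpace : CompleteSpace carrier]
  [module : Module (FunctionAlgebra Ω) carrier]
  [isScalarTower : IsScalarTower ℂ (FunctionAlgebra Ω) carrier]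
  [continuousSMul : ContinuousSMul (FunctionAlgebra Ω) carrier]

namespace HilbertModule

variable {m : ℕ} {Ω : Set (Fin m → ℂ)}

instance : CoeSort (HilbertModule.{u} Ω) (Type u) := ⟨HilbertModule.carrier⟩

attribute [instance] normedAddCommGroup innerProductSpace completeSpace module isScalarTower
  continuousSMul

/-- The one-dimensional Hilbert module `ℂ_z`, on which `φ` acts as multiplication by `φ(z)`. -/
def point (z : Ω) : HilbertModule.{0} Ω :=
  letI : Module (FunctionAlgebra Ω) ℂ := Module.compHom ℂ (evalAt z)
  { carrier := ℂ
    isScalarTower := ⟨fun c φ w => by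
      change (c * (φ : Ω →ᵇ ℂ) z) * w = c * ((φ : Ω →ᵇ ℂ) z * w)
      ring⟩
    continuousSMul := ⟨by
      change Continuous fun p : FunctionAlgebra Ω × ℂ => (p.1 : Ω →ᵇ ℂ) z * p.2
      have h : Continuous fun p : FunctionAlgebra Ω × ℂ => (p.1 : Ω →ᵇ ℂ) z :=
        (continuous_eval_const z).comp (continuous_subtype_val.comp continuous_fst)
      exact h.mul continuous_snd⟩ }

/-- The vector `1_z` of `ℂ_z`. -/
def pointOne (z : Ω) : point z := (1 : ℂ)

/-- The Hilbert space tensor product `M ⊗ N`. -/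
abbrev HilbertTensor (M : HilbertModule.{u} Ω) (N : HilbertModule.{v} Ω) : Type (max u v) :=
  UniformSpace.Completion (M ⊗[ℂ] N)

/-- The closed subspace of `M ⊗ N` spanned by the vectors `φ f ⊗ g - f ⊗ φ g`. The set of these
vectors is invariant under both module multiplications, so this is also the closed submodule
that they generate. -/
def balancing (M : HilbertModule.{u} Ω) (N : HilbertModule.{v} Ω) :
    Submodule ℂ (HilbertTensor M N) :=
  (Submodule.span ℂ {x | ∃ (φ : FunctionAlgebra Ω) (f : M) (g : N),
    x = (((φ • f) ⊗ₜ[ℂ] g - f ⊗ₜ[ℂ] (φ • g) : M ⊗[ℂ] N) : HilbertTensor M N)}).topologicalClosure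

instance (M : HilbertModule.{u} Ω) (N : HilbertModule.{v} Ω) :
    IsClosed (balancing M N : Set (HilbertTensor M N)) :=
  Submodule.isClosed_topologicalClosure _

/-- The module tensor product `M ⊗_𝒜 N`, with the quotient norm. -/
abbrev ModuleTensor (M : HilbertModule.{u} Ω) (N : HilbertModule.{v} Ω) : Type (max u v) :=
  HilbertTensor M N ⧸ balancing M N

/-- The vector `f ⊗_𝒜 g` of `M ⊗_𝒜 N`. -/
def tmulA {M : HilbertModule.{u} Ω} {N : HilbertModule.{v} Ω} (f : M) (g : N) :
    ModuleTensor M N :=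
  (balancing M N).mkQ ((f ⊗ₜ[ℂ] g : M ⊗[ℂ] N) : HilbertTensor M N)

/-- The fibre `Sp_z(M) = M ⊗_𝒜 ℂ_z` of the spectral sheaf. -/
abbrev Fiber (M : HilbertModule.{u} Ω) (z : Ω) : Type u := ModuleTensor M (point z)

/-- The localization `f ⊗_𝒜 1_z` of a vector `f`. -/
def loc {M : HilbertModule.{u} Ω} (z : Ω) (f : M) : Fiber M z := tmulA f (pointOne z)

/-- A family of vectors generates `M` if the submodule that it generates algebraically is
dense. -/
def Generates {ι : Type v} {M : HilbertModule.{u} Ω} (f : ι → M) : Prop :=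
  Dense (Submodule.span (FunctionAlgebra Ω) (Set.range f) : Set M)

/-- `M` is generated by countably many vectors. -/
def CountablyGenerated (M : HilbertModule.{u} Ω) : Prop := ∃ f : ℕ → M, Generates f

end HilbertModule

open Classical in
/-- For a linearly independent family `v`, the linear map from the (algebraic) linear span of `v`
to `ℓ²(ι)` that sends `v i` to the standard basis vector `e i`. -/
def coordMap {ι : Type u} {E : Type v} [AddCommGroup E] [Module ℂ E] {v : ι → E}
    (hv : LinearIndependent ℂ v) :
    Submodule.span ℂ (Set.range v) →ₗ[ℂ] ℓ²(ι, ℂ) :=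
  (Finsupp.linearCombination ℂ fun i : ι => (lp.single 2 i (1 : ℂ) : ℓ²(ι, ℂ))) ∘ₗ hv.repr

open HilbertModule

variable {m : ℕ} {Ω : Set (Fin m → ℂ)}

/-- `R` is quasi-free relative to the nonempty generating family `f`; its rank is then the
cardinality of `ι`. The localizations of the generators form a basis of each fibre in the sense
that they are linearly independent and that their linear span is dense; for a finite family the
latter says that they span the fibre. -/
structure IsQuasiFree {ι : Type v} (R : HilbertModule.{u} Ω) (f : ι → R) : Prop where
  nonempty : Nonempty ι
  generates : Generates f
  linearIndependent : ∀ z : Ω, LinearIndependent ℂ fun i => loc z (f i)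
  spans : ∀ z : Ω, Dense (Submodule.span ℂ (Set.range fun i => loc z (f i)) : Set (Fiber R z))
  locallyBounded : ∀ z₀ : Ω, ∃ C : ℝ, ∀ᶠ z in nhds z₀,
    ∀ w, ‖coordMap (linearIndependent z) w‖ ≤ C * ‖w‖
  faithful : ∀ h : R, (∀ z : Ω, loc z h = 0) ↔ h = 0

/-- `M` is smooth relative to `R` and `g`: the map `f ↦ f ⊗_𝒜 g` is one-to-one. -/
def IsSmooth (M : HilbertModule.{u} Ω) (R : HilbertModule.{v} Ω) (g : R) : Prop :=
  Function.Injective fun f : M => tmulA f g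

/-- The class (SM): smooth relative to some `R` that is quasi-free of rank one relative to `g`. -/
def ClassSM (M : HilbertModule.{u} Ω) : Prop :=
  ∃ (R : HilbertModule.{u} Ω) (g : R), IsQuasiFree R (fun _ : Unit => g) ∧ IsSmooth M R g

/-- `R` is quasi-free of rank `k`, where `k ≥ 1` is any cardinal number. -/
def IsQuasiFreeOfRank (R : HilbertModule.{u} Ω) (k : Cardinal.{u}) : Prop :=
  ∃ (ι : Type u) (f : ι → R), Cardinal.mk ι = k ∧ IsQuasiFree R f

/-- A weak (topologically exact) resolution `0 ← M ← R 0 ← R 1 ← ⋯` of `M` by quasi-free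
Hilbert modules; the maps are bounded module maps. A resolution of finite length is one whose
modules are all zero from some index on; the modules before that index are quasi-free. -/
structure WeakResolution (M : HilbertModule.{u} Ω) where
  /-- The resolving modules. -/
  R : ℕ → HilbertModule.{u} Ω
  /-- The module map onto a dense subspace of `M`. -/
  aug : R 0 →L[FunctionAlgebra Ω] M
  /-- The module maps between consecutive resolving modules. -/
  X : ∀ n, R (n + 1) →L[FunctionAlgebra Ω] R n
  denseRange : DenseRange aug
  exact_zero : {x | aug x = 0} = closure (Set.range (X 0))
  exact_succ : ∀ n, {x | X n x = 0} = closure (Set.range (X (n + 1)))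
  quasiFree : ∀ n, (∃ k, IsQuasiFreeOfRank (R n) k) ∨ ∀ l, n ≤ l → Subsingleton (R l)

end QuasiFreeResolution

end

/-! Everything rests on one covering step, `IsSmooth.exists_cover`, applied repeatedly with `R` and
`g` fixed. Let `b` be an orthonormal basis of a smooth module `N`, and let `P` be the closed
submodule of `ℓ²(R) ⊕ N` generated by the vectors `(g in slot i, b i)`. The second projection `X`
has dense range, as it hits every `b i`. The first projection `Y` is injective: with `J : ℓ²(R) → N
⊗ R` sending `r` in slot `i` to `b i ⊗ r`, the identity `J (Y x) ≡ X x ⊗ g` modulo the balancing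
subspace extends from the generators to `P`, so `Y x = 0` forces `X x ⊗_𝒜 g = 0`, hence `X x = 0` by
smoothness, hence `x = 0`. By `IsQuasiFree.exists_eval`, `R` has locally bounded separating
evaluations `l z` with `l z g = 1`. Applied coordinatewise after `Y`, they send the generators of
`P` to the standard basis of `ℓ²`, and `IsQuasiFree.of_coordinates` makes `P` quasi-free. They also
separate the kernel of `X`, which is therefore smooth by `isSmooth_of_separating`, and the step can
be repeated. Separability of `𝒜(Ω)` carries separability from each module to the next, which keeps
all the bases countable. -/

noncomputable section

namespace QuasiFreeResolution

universe u v

section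

/-! ### Coordinatewise operators on square-summable families. -/

section Lp

variable {ι : Type*} {E F : Type*} [NormedAddCommGroup E] [InnerProductSpace ℂ E]
  [NormedAddCommGroup F] [InnerProductSpace ℂ F]

theorem norm_apply_le_norm_smul (T : E →L[ℂ] F) (x : lp (fun _ : ι => E) 2) (i : ι) :
    ‖T (x i)‖ ≤ ‖(((‖T‖ : ℂ) • x : lp (fun _ : ι => E) 2) : ι → E) i‖ := by
  rw [lp.coeFn_smul, Pi.smul_apply, norm_smul, Complex.norm_real, norm_norm]
  exact T.le_opNorm (x i)

/-- The coordinatewise action of a bounded operator on square-summable families. -/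
def lpMapₗ (ι : Type*) (T : E →L[ℂ] F) :
    lp (fun _ : ι => E) 2 →ₗ[ℂ] lp (fun _ : ι => F) 2 where
  toFun x := ⟨fun i => T (x i), (lp.memℓp ((‖T‖ : ℂ) • x)).mono' (norm_apply_le_norm_smul T x)⟩
  map_add' x y := lp.ext (funext fun i => T.map_add (x i) (y i))
  map_smul' c x := lp.ext (funext fun i => T.map_smul c (x i))

theorem norm_lpMapₗ_apply_le (T : E →L[ℂ] F) (x : lp (fun _ : ι => E) 2) :
    ‖lpMapₗ ι T x‖ ≤ ‖T‖ * ‖x‖ := by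
  refine (lp.norm_mono two_ne_zero (y := (‖T‖ : ℂ) • x) (norm_apply_le_norm_smul T x)).trans ?_
  rw [norm_smul, Complex.norm_real, norm_norm]

/-- The coordinatewise action of a bounded operator on square-summable families, as a bounded
operator. -/
def lpMap (ι : Type*) (T : E →L[ℂ] F) : lp (fun _ : ι => E) 2 →L[ℂ] lp (fun _ : ι => F) 2 :=
  (lpMapₗ ι T).mkContinuous ‖T‖ (norm_lpMapₗ_apply_le T)

@[simp]
theorem lpMap_apply (T : E →L[ℂ] F) (x : lp (fun _ : ι => E) 2) (i : ι) :
    lpMap ι T x i = T (x i) := rfl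

theorem norm_lpMap_le (T : E →L[ℂ] F) : ‖lpMap ι T‖ ≤ ‖T‖ :=
  LinearMap.mkContinuous_norm_le _ (norm_nonneg _) (norm_lpMapₗ_apply_le T)

theorem lpMap_single [DecidableEq ι] (T : E →L[ℂ] F) (i : ι) (x : E) :
    lpMap ι T (lp.single 2 i x) = lp.single 2 i (T x) := by
  ext j
  rcases eq_or_ne j i with rfl | h
  · simp
  · simp [h]

end Lp

/-! ### Continuity of a module action as a norm inequality. -/

section BoundedAction

variable {A E : Type*} [NormedRing A] [NormedAlgebra ℂ A] [NormedAddCommGroup E]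
  [NormedSpace ℂ E] [Module A E] [IsScalarTower ℂ A E]

/-- Continuity at the origin gives a `δ` that makes small products have norm less than 1; rescaling
both factors to norm `δ / 2` produces the constant `4 / δ ^ 2`. An infinite direct sum of copies
needs such a bound, uniform over the coordinates. -/
theorem exists_norm_smul_le_of_continuousSMul [ContinuousSMul A E] :
    ∃ K : ℝ, 0 ≤ K ∧ ∀ (a : A) (x : E), ‖a • x‖ ≤ K * ‖a‖ * ‖x‖ := by
  have h : Filter.Tendsto (fun p : A × E => p.1 • p.2) (nhds (0, 0)) (nhds 0) := by
    simpa using (continuous_smul (M := A) (X := E)).tendsto (0, 0)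
  obtain ⟨δ, hδ, H⟩ := Metric.eventually_nhds_iff.1 (h.eventually (Metric.ball_mem_nhds 0 one_pos))
  have H' : ∀ (a : A) (x : E), ‖a‖ < δ → ‖x‖ < δ → ‖a • x‖ < 1 := by
    intro a x h1 h2
    have := @H (a, x) (by
      rw [Prod.dist_eq, max_lt_iff, dist_zero_right, dist_zero_right]; exact ⟨h1, h2⟩)
    simpa using this
  refine ⟨4 / δ ^ 2, by positivity, fun a x => ?_⟩
  by_cases ha : a = 0
  · simp [ha]
  by_cases hx : x = 0
  · simp [hx]
  have ha' : 0 < ‖a‖ := norm_pos_iff.2 ha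
  have hx' : 0 < ‖x‖ := norm_pos_iff.2 hx
  have key := H' (((δ / (2 * ‖a‖) : ℝ) : ℂ) • a) (((δ / (2 * ‖x‖) : ℝ) : ℂ) • x)
    (by
      rw [norm_smul, Complex.norm_real, Real.norm_of_nonneg (by positivity)]
      field_simp; linarith)
    (by
      rw [norm_smul, Complex.norm_real, Real.norm_of_nonneg (by positivity)]
      field_simp; linarith)
  have hc : SMulCommClass ℂ A E := IsScalarTower.to_smulCommClass
  rw [smul_assoc, ← smul_comm _ a x, norm_smul, norm_smul, Complex.norm_real, Complex.norm_real,
    Real.norm_of_nonneg (by positivity), Real.norm_of_nonneg (by positivity)] at key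
  field_simp at key ⊢
  linarith

theorem continuousSMul_of_norm_smul_le {K : ℝ} (h : ∀ (a : A) (x : E), ‖a • x‖ ≤ K * ‖a‖ * ‖x‖) :
    ContinuousSMul A E := by
  have hc : SMulCommClass ℂ A E := IsScalarTower.to_smulCommClass
  let B : A →ₗ[ℂ] E →ₗ[ℂ] E := LinearMap.mk₂ ℂ (fun a x => a • x) add_smul
    (fun c a x => smul_assoc c a x) smul_add (fun c a x => (smul_comm c a x).symm)
  exact ⟨(B.mkContinuous₂ K h).continuous₂⟩

end BoundedAction

/-! ### Direct sums and closed submodules of Hilbert modules. -/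

namespace HilbertModule

variable {m : ℕ} {Ω : Set (Fin m → ℂ)}

instance (M : HilbertModule.{u} Ω) : SMulCommClass ℂ (FunctionAlgebra Ω) M :=
  IsScalarTower.to_smulCommClass

/-- Multiplication by an element of `𝒜(Ω)`, as a bounded operator. -/
def smulCLM (M : HilbertModule.{u} Ω) (φ : FunctionAlgebra Ω) : M →L[ℂ] M where
  toFun f := φ • f
  map_add' := smul_add φ
  map_smul' c f := (smul_comm c φ f).symm
  cont := continuous_const_smul φ

/-- The Hilbert space direct sum of copies of a Hilbert module. -/
def l2Sum (ι : Type u) (M : HilbertModule.{u} Ω) : HilbertModule.{u} Ω :=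
  letI : Module (FunctionAlgebra Ω) (lp (fun _ : ι => (M : Type u)) 2) :=
    { smul := fun φ x => lpMap ι (M.smulCLM φ) x
      one_smul := fun x => lp.ext (funext fun i => one_smul (FunctionAlgebra Ω) (x i))
      mul_smul := fun φ ψ x => lp.ext (funext fun i => mul_smul φ ψ (x i))
      smul_zero := fun φ => (lpMap ι (M.smulCLM φ)).map_zero
      smul_add := fun φ => (lpMap ι (M.smulCLM φ)).map_add
      add_smul := fun φ ψ x => lp.ext (funext fun i => add_smul φ ψ (x i))
      zero_smul := fun x => lp.ext (funext fun i => zero_smul (FunctionAlgebra Ω) (x i)) }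
  letI : IsScalarTower ℂ (FunctionAlgebra Ω) (lp (fun _ : ι => (M : Type u)) 2) :=
    ⟨fun c φ x => lp.ext (funext fun i => smul_assoc c φ (x i))⟩
  { carrier := lp (fun _ : ι => (M : Type u)) 2
    continuousSMul := by
      obtain ⟨K, hK, h⟩ := exists_norm_smul_le_of_continuousSMul (A := FunctionAlgebra Ω) (E := M)
      refine continuousSMul_of_norm_smul_le (K := K) fun φ x => ?_
      have h1 : ‖M.smulCLM φ‖ ≤ K * ‖φ‖ :=
        ContinuousLinearMap.opNorm_le_bound _ (by positivity) (h φ)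
      exact ((lpMap ι (M.smulCLM φ)).le_of_opNorm_le ((norm_lpMap_le _).trans h1) x) }

/-- The Hilbert space direct sum of two Hilbert modules. -/
def prod (M N : HilbertModule.{u} Ω) : HilbertModule.{u} Ω where
  carrier := WithLp 2 (M × N)
  continuousSMul := ⟨by
    refine (WithLp.prod_continuous_toLp 2 M N).comp (f := fun p : FunctionAlgebra Ω ×
      WithLp 2 (M × N) => p.1 • WithLp.ofLp p.2) ?_
    exact continuous_fst.smul ((WithLp.prod_continuous_ofLp 2 M N).comp continuous_snd)⟩

/-- A closed submodule of a Hilbert module. -/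
def ofSubmodule (M : HilbertModule.{u} Ω) (S : Submodule (FunctionAlgebra Ω) M)
    (hS : IsClosed (S : Set M)) : HilbertModule.{u} Ω :=
  have : CompleteSpace (S.restrictScalars ℂ) := hS.completeSpace_coe
  { carrier := S.restrictScalars ℂ
    module := Submodule.restrictScalars.origModule ℂ (FunctionAlgebra Ω) M S
    continuousSMul := ⟨by
      refine Continuous.subtype_mk ?_ _
      exact continuous_fst.smul (continuous_subtype_val.comp continuous_snd)⟩ }

/-- The inclusion of a closed submodule. -/
def subtypeA (M : HilbertModule.{u} Ω) (S : Submodule (FunctionAlgebra Ω) M)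
    (hS : IsClosed (S : Set M)) : M.ofSubmodule S hS →L[FunctionAlgebra Ω] M where
  toFun x := x.1
  map_add' _ _ := rfl
  map_smul' _ _ := rfl
  cont := continuous_subtype_val

end HilbertModule

end

/-! ### Fibres, localization and evaluation functionals. -/

section

namespace HilbertModule

variable {m : ℕ} {Ω : Set (Fin m → ℂ)}

/-- The map `f ↦ f ⊗_𝒜 g`, as a bounded operator. -/
def tmulACLM (M : HilbertModule.{u} Ω) {N : HilbertModule.{v} Ω} (g : N) :
    M →L[ℂ] ModuleTensor M N :=
  (balancing M N).mkQL ∘L UniformSpace.Completion.toComplL ∘L (TensorProduct.mkL ℂ M N).flip g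

@[simp]
theorem tmulACLM_apply {M : HilbertModule.{u} Ω} {N : HilbertModule.{v} Ω} (f : M) (g : N) :
    tmulACLM M g f = tmulA f g := rfl

theorem tmulA_smul {M : HilbertModule.{u} Ω} {N : HilbertModule.{v} Ω} (φ : FunctionAlgebra Ω)
    (f : M) (g : N) : tmulA f (φ • g) = tmulA (φ • f) g := by
  symm
  refine (Submodule.Quotient.eq _).2 ?_
  refine Submodule.le_topologicalClosure _ (Submodule.subset_span ⟨φ, f, g, ?_⟩)
  exact (UniformSpace.Completion.coe_sub _ _).symm

theorem isSmooth_iff {M : HilbertModule.{u} Ω} {N : HilbertModule.{v} Ω} {g : N} :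
    IsSmooth M N g ↔ ∀ f : M, tmulA f g = 0 → f = 0 :=
  injective_iff_map_eq_zero (tmulACLM M g)

/-- A bounded operator on `M` that intertwines the action of `𝒜(Ω)` with evaluation at `z`. -/
def IsEvalLinear {M : HilbertModule.{u} Ω} {E : Type*} [NormedAddCommGroup E]
    [NormedSpace ℂ E] (z : Ω) (T : M →L[ℂ] E) : Prop :=
  ∀ (φ : FunctionAlgebra Ω) (f : M), T (φ • f) = evalAt z φ • T f

/-- The coordinate of a vector of `ℂ_z` with respect to `1_z`. -/
def pointCoord {z : Ω} (c : point z) : ℂ := c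

theorem norm_loc_le {M : HilbertModule.{u} Ω} (z : Ω) (f : M) : ‖loc z f‖ ≤ ‖f‖ := by
  refine (Submodule.Quotient.norm_mk_le _ _).trans_eq ?_
  have h : ‖pointOne z‖ = 1 := norm_one (α := ℂ)
  rw [UniformSpace.Completion.norm_coe, TensorProduct.norm_tmul, h, mul_one]

theorem loc_isEvalLinear {M : HilbertModule.{u} Ω} (z : Ω) :
    IsEvalLinear z (tmulACLM M (pointOne z)) := by
  intro φ f
  rw [tmulACLM_apply, ← tmulA_smul]
  have h1 : φ • pointOne z = evalAt z φ • pointOne z := rfl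
  rw [h1, tmulA, TensorProduct.tmul_smul, UniformSpace.Completion.coe_smul, map_smul]
  rfl

/-- An operator that intertwines the action with evaluation at `z` factors through the fibre
at `z`. -/
theorem exists_fiber_lift {M : HilbertModule.{u} Ω} {E : Type*} [NormedAddCommGroup E]
    [NormedSpace ℂ E] [CompleteSpace E] {z : Ω} {T : M →L[ℂ] E} (hT : IsEvalLinear z T) :
    ∃ S : Fiber M z →L[ℂ] E, (∀ f, S (loc z f) = T f) ∧ ∀ x, ‖S x‖ ≤ ‖T‖ * ‖x‖ := by
  -- Since `M ⊗ ℂ_z` is isometric to `M`, `T` transfers to it and extends to the completion without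
  -- increase of norm.
  let rid : (M ⊗[ℂ] point z) →ₗᵢ[ℂ] M := (TensorProduct.ridIsometry ℂ M).toLinearIsometry
  have hrid (f : M) (c : point z) : rid (f ⊗ₜ[ℂ] c) = pointCoord c • f :=
    TensorProduct.rid_tmul f (pointCoord c)
  let T₁ : (M ⊗[ℂ] point z) →L[ℂ] E := T ∘L rid.toContinuousLinearMap
  let e : (M ⊗[ℂ] point z) →L[ℂ] HilbertTensor M (point z) := UniformSpace.Completion.toComplL
  have he : DenseRange e := UniformSpace.Completion.denseRange_coe
  have he' : IsUniformInducing e := UniformSpace.Completion.isUniformInducing_coe _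
  let T₂ : HilbertTensor M (point z) →L[ℂ] E := T₁.extend e
  have hT₂ (x : M ⊗[ℂ] point z) : T₂ (x : HilbertTensor M (point z)) = T (rid x) :=
    ContinuousLinearMap.extend_eq T₁ he he' x
  have hT₂n (x : HilbertTensor M (point z)) : ‖T₂ x‖ ≤ ‖T‖ * ‖x‖ := by
    induction x using UniformSpace.Completion.induction_on with
    | hp => exact isClosed_le (by fun_prop) (by fun_prop)
    | ih x =>
      rw [hT₂, UniformSpace.Completion.norm_coe, ← rid.norm_map x]
      exact T.le_opNorm _
  have hker : balancing M (point z) ≤ T₂.ker := by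
    refine Submodule.topologicalClosure_minimal _ (Submodule.span_le.2 ?_) T₂.isClosed_ker
    rintro _ ⟨φ, f, c, rfl⟩
    change T₂ _ = 0
    have h1 : rid (f ⊗ₜ[ℂ] (φ • c)) = (evalAt z φ * pointCoord c) • f := hrid f (φ • c)
    rw [hT₂, map_sub, hrid, h1, map_sub, T.map_smul, T.map_smul, hT, smul_smul, mul_comm, sub_self]
  refine ⟨(balancing M (point z)).liftQL T₂ hker, fun f => ?_, fun x => ?_⟩
  · change T₂ _ = _
    rw [hT₂]
    exact congrArg T ((hrid f (pointOne z)).trans (one_smul ℂ f))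
  -- The quotient norm is only an infimum over representatives; the `+ 1` in the denominator covers
  -- `T = 0`.
  · refine le_of_forall_pos_le_add fun ε hε => ?_
    obtain ⟨y, rfl, hy⟩ :=
      Submodule.Quotient.norm_mk_lt x (ε := ε / (‖T‖ + 1)) (by positivity)
    calc ‖T₂ y‖ ≤ ‖T‖ * ‖y‖ := hT₂n y
      _ ≤ ‖T‖ * (‖(Submodule.Quotient.mk y : Fiber M z)‖ + ε / (‖T‖ + 1)) := by gcongr
      _ = ‖T‖ * ‖(Submodule.Quotient.mk y : Fiber M z)‖ + ‖T‖ / (‖T‖ + 1) * ε := by ring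
      _ ≤ ‖T‖ * ‖(Submodule.Quotient.mk y : Fiber M z)‖ + 1 * ε := by
        gcongr
        exact (div_le_one (by positivity)).2 (by linarith)
      _ = _ := by rw [one_mul]

/-- As `ℂ_z` is spanned by `1_z`, every algebraic tensor is of the form `f ⊗ 1_z`, and these are
dense in the completion. -/
theorem denseRange_loc {M : HilbertModule.{u} Ω} (z : Ω) :
    DenseRange (loc z : M → Fiber M z) := by
  have h1 : DenseRange (fun x : M ⊗[ℂ] point z =>
      (balancing M (point z)).mkQ (x : HilbertTensor M (point z))) :=
    (Submodule.mkQ_surjective _).denseRange.comp UniformSpace.Completion.denseRange_coe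
      (balancing M (point z)).mkQL.continuous
  refine h1.mono ?_
  rintro _ ⟨x, rfl⟩
  induction x using TensorProduct.induction_on with
  | zero => exact ⟨0, (tmulACLM M (pointOne z)).map_zero⟩
  | tmul f c =>
    refine ⟨pointCoord c • f, ?_⟩
    have h : c = pointCoord c • pointOne z := (mul_one (pointCoord c)).symm
    rw [loc, tmulA, TensorProduct.smul_tmul, ← h]
  | add x y hx hy =>
    obtain ⟨f, hf⟩ := hx
    obtain ⟨g, hg⟩ := hy
    refine ⟨f + g, ((tmulACLM M (pointOne z)).map_add f g).trans ?_⟩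
    dsimp only at hf hg ⊢
    rw [UniformSpace.Completion.coe_add, map_add, ← hf, ← hg]
    rfl

/-- Only the vectors `φ • f i` are tested, so `p` may concern a target on which no `𝒜`-action is in
use, such as `ModuleTensor`. -/
theorem span_range_induction {M : HilbertModule.{u} Ω} {ι : Type v} {f : ι → M} {p : M → Prop}
    (zero : p 0) (add : ∀ x y, p x → p y → p (x + y))
    (smul : ∀ (φ : FunctionAlgebra Ω) i, p (φ • f i)) :
    ∀ x ∈ Submodule.span (FunctionAlgebra Ω) (Set.range f), p x := by
  intro x hx
  obtain ⟨c, rfl⟩ := Finsupp.mem_span_range_iff_exists_finsupp.1 hx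
  exact Finset.sum_induction _ p add zero fun i _ => smul (c i) i

/-- Localization turns `φ` into the scalar `φ(z)`, so it maps the `𝒜`-span into the complex span.
The density condition of quasi-freeness is thus automatic for generators. -/
theorem Generates.dense_span_loc {M : HilbertModule.{u} Ω} {ι : Type v} {f : ι → M}
    (hf : Generates f) (z : Ω) :
    Dense (Submodule.span ℂ (Set.range fun i => loc z (f i)) : Set (Fiber M z)) := by
  have hd : Dense (loc z '' (Submodule.span (FunctionAlgebra Ω) (Set.range f) : Set M)) :=
    (denseRange_loc z).dense_image (tmulACLM M (pointOne z)).continuous hf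
  refine hd.mono ?_
  rintro _ ⟨x, hx, rfl⟩
  refine span_range_induction
    (p := fun x => loc z x ∈ Submodule.span ℂ (Set.range fun i => loc z (f i))) ?_ ?_ ?_ x hx
  · rw [show loc z (0 : M) = 0 from (tmulACLM M (pointOne z)).map_zero]
    exact zero_mem _
  · intro x y hx hy
    rw [show loc z (x + y) = loc z x + loc z y from (tmulACLM M (pointOne z)).map_add x y]
    exact add_mem hx hy
  · intro φ i
    rw [show loc z (φ • f i) = evalAt z φ • loc z (f i) from loc_isEvalLinear z φ (f i)]
    exact Submodule.smul_mem _ _ (Submodule.subset_span ⟨i, rfl⟩)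

/-- A module that is separated by functionals intertwining the action with point evaluations is
smooth relative to every `R` carrying enough such functionals that do not vanish at `g`. -/
theorem isSmooth_of_separating {M : HilbertModule.{u} Ω} {R : HilbertModule.{v} Ω} {g : R}
    (hR : ∀ z : Ω, ∃ l : R →L[ℂ] ℂ, IsEvalLinear z l ∧ l g = 1)
    (hM : ∀ f : M, (∀ (z : Ω) (t : M →L[ℂ] ℂ), IsEvalLinear z t → t f = 0) → f = 0) :
    IsSmooth M R g := by
  refine isSmooth_iff.2 fun f hf => hM f fun z t ht => ?_
  obtain ⟨l, hl, hlg⟩ := hR z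
  let a := (InnerProductSpace.toDual ℂ M).symm t
  let b := (InnerProductSpace.toDual ℂ R).symm l
  have ha (x : M) : inner ℂ a x = t x := InnerProductSpace.toDual_symm_apply
  have hb (x : R) : inner ℂ b x = l x := InnerProductSpace.toDual_symm_apply
  -- Through the Riesz vectors, `s` is the functional `t ⊗ l`. It kills the balancing vectors
  -- because `t` and `l` both turn `φ` into `φ(z)`.
  let s : HilbertTensor M R →L[ℂ] ℂ := innerSL ℂ ((a ⊗ₜ[ℂ] b : M ⊗[ℂ] R) : HilbertTensor M R)
  have hs (x : M) (y : R) : s ((x ⊗ₜ[ℂ] y : M ⊗[ℂ] R) : HilbertTensor M R) = t x * l y := by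
    rw [innerSL_apply_apply, UniformSpace.Completion.inner_coe, TensorProduct.inner_tmul, ha, hb]
  have hker : balancing M R ≤ s.ker := by
    refine Submodule.topologicalClosure_minimal _ (Submodule.span_le.2 ?_) s.isClosed_ker
    rintro _ ⟨φ, x, y, rfl⟩
    change s _ = 0
    rw [UniformSpace.Completion.coe_sub, map_sub, hs, hs, ht, hl, smul_eq_mul, smul_eq_mul]
    ring
  have h0 : s ((f ⊗ₜ[ℂ] g : M ⊗[ℂ] R) : HilbertTensor M R) = 0 :=
    hker ((Submodule.Quotient.mk_eq_zero _).1 hf)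
  rwa [hs, hlg, mul_one] at h0

end HilbertModule

open HilbertModule

variable {m : ℕ} {Ω : Set (Fin m → ℂ)}

-- Used to replace the algebraically defined coordinates by an operator whose norm is known.
open Classical in
theorem coordMap_eq {ι : Type u} {E : Type v} [AddCommGroup E] [Module ℂ E] {v : ι → E}
    (hv : LinearIndependent ℂ v) (S : E →ₗ[ℂ] ℓ²(ι, ℂ))
    (hS : ∀ i, S (v i) = lp.single 2 i (1 : ℂ)) (w : Submodule.span ℂ (Set.range v)) :
    coordMap hv w = S w := by
  conv_rhs => rw [← hv.linearCombination_repr w]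
  rw [coordMap, LinearMap.comp_apply, Finsupp.apply_linearCombination]
  congr 1
  congr 1
  funext i
  exact (hS i).symm

/-- A module that is quasi-free of rank one is a Hilbert space of functions on `Ω`: its vectors
are separated by locally bounded evaluation functionals. -/
theorem IsQuasiFree.exists_eval {R : HilbertModule.{u} Ω} {g : R}
    (h : IsQuasiFree R fun _ : Unit => g) :
    ∃ l : Ω → R →L[ℂ] ℂ, (∀ z, IsEvalLinear z (l z)) ∧ (∀ z, l z g = 1) ∧
      (∀ z₀, ∃ C : ℝ, ∀ᶠ z in nhds z₀, ‖l z‖ ≤ C) ∧ ∀ r, (∀ z, l z r = 0) → r = 0 := by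
  have hne (z : Ω) : loc z g ≠ 0 := (h.linearIndependent z).ne_zero ()
  have hmem (z : Ω) (x : Fiber R z) : x ∈ Submodule.span ℂ {loc z g} := by
    have h1 := h.spans z
    rw [Set.range_const] at h1
    -- A dense finite-dimensional subspace is closed, hence the whole fibre.
    have h2 : IsClosed (Submodule.span ℂ {loc z g} : Set (Fiber R z)) :=
      Submodule.closed_of_finiteDimensional _
    have h3 := h1.closure_eq
    rw [h2.closure_eq] at h3
    exact h3.symm.subset (Set.mem_univ x)
  have hex (z : Ω) : ∃ l : Fiber R z →L[ℂ] ℂ, l (loc z g) = 1 := by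
    obtain ⟨l, hl⟩ := SeparatingDual.exists_eq_one (R := ℂ) (hne z)
    exact ⟨l, hl⟩
  choose e he using hex
  have hx (z : Ω) (x : Fiber R z) : x = e z x • loc z g := by
    obtain ⟨c, rfl⟩ := Submodule.mem_span_singleton.1 (hmem z x)
    rw [map_smul, he, smul_eq_mul, mul_one]
  refine ⟨fun z => e z ∘L tmulACLM R (pointOne z), fun z φ f => ?_, he, fun z₀ => ?_, fun r hr => ?_⟩
  · rw [ContinuousLinearMap.comp_apply, loc_isEvalLinear, map_smul]
    rfl
  · obtain ⟨C, hC⟩ := h.locallyBounded z₀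
    refine ⟨max C 0, ?_⟩
    filter_upwards [hC] with z hz
    refine ContinuousLinearMap.opNorm_le_bound _ (le_max_right _ _) fun r => ?_
    have hr : loc z r ∈ Submodule.span ℂ (Set.range fun _ : Unit => loc z g) := by
      rw [Set.range_const]
      exact hmem z _
    have h1 := coordMap_eq (h.linearIndependent z)
      ((e z).smulRight (lp.single 2 () (1 : ℂ) : ℓ²(Unit, ℂ))).toLinearMap
      (fun _ => by
        refine (congrArg (· • (lp.single 2 () (1 : ℂ) : ℓ²(Unit, ℂ))) (he z)).trans ?_
        rw [one_smul]
        congr!) ⟨loc z r, hr⟩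
    have h2 := hz ⟨loc z r, hr⟩
    rw [h1] at h2
    change ‖e z (loc z r) • (lp.single 2 () (1 : ℂ) : ℓ²(Unit, ℂ))‖ ≤ C * ‖loc z r‖ at h2
    rw [norm_smul, lp.norm_single (by norm_num), norm_one, mul_one] at h2
    calc ‖e z (loc z r)‖ ≤ C * ‖loc z r‖ := h2
      _ ≤ max C 0 * ‖r‖ := mul_le_mul (le_max_left _ _) (norm_loc_le z r) (norm_nonneg _)
        (le_max_right _ _)
  · refine (h.faithful r).1 fun z => ?_
    rw [hx z (loc z r), show e z (loc z r) = 0 from hr z, zero_smul]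

end

/-! ### Generated submodules, kernels and the operator into the tensor product. -/

section

theorem countable_of_orthonormal {ι E : Type*} [NormedAddCommGroup E] [InnerProductSpace ℂ E]
    [TopologicalSpace.SeparableSpace E] {b : ι → E} (hb : Orthonormal ℂ b) : Countable ι := by
  refine Pairwise.countable_of_isOpen_disjoint (s := fun i => Metric.ball (b i) (1 / 2)) ?_
    (fun i => Metric.isOpen_ball) fun i => Metric.nonempty_ball.2 (by norm_num)
  intro i j hij
  refine Metric.ball_disjoint_ball ?_
  have h1 := norm_sub_sq (𝕜 := ℂ) (b i) (b j)
  rw [hb.1, hb.1, hb.2 hij, map_zero] at h1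
  rw [dist_eq_norm]
  nlinarith [norm_nonneg (b i - b j)]

namespace HilbertModule

variable {m : ℕ} {Ω : Set (Fin m → ℂ)}

/-- The coordinates of a direct sum of copies of a Hilbert module. -/
def l2SumEval {ι : Type u} {M : HilbertModule.{u} Ω} (i : ι) :
    l2Sum ι M →L[FunctionAlgebra Ω] M where
  toFun x := lp.evalCLM ℂ (fun _ : ι => (M : Type u)) 2 i x
  map_add' := (lp.evalCLM ℂ (fun _ : ι => (M : Type u)) 2 i).map_add
  map_smul' _ _ := rfl
  cont := (lp.evalCLM ℂ (fun _ : ι => (M : Type u)) 2 i).continuous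

/-- The first projection of a direct sum. -/
def prodFst (M N : HilbertModule.{u} Ω) : prod M N →L[FunctionAlgebra Ω] M where
  toFun x := WithLp.fst (p := 2) (α := M) (β := N) x
  map_add' _ _ := rfl
  map_smul' _ _ := rfl
  cont := continuous_fst.comp (WithLp.prod_continuous_ofLp 2 M N)

/-- The second projection of a direct sum. -/
def prodSnd (M N : HilbertModule.{u} Ω) : prod M N →L[FunctionAlgebra Ω] N where
  toFun x := WithLp.snd (p := 2) (α := M) (β := N) x
  map_add' _ _ := rfl
  map_smul' _ _ := rfl
  cont := continuous_snd.comp (WithLp.prod_continuous_ofLp 2 M N)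

theorem norm_prodFst_le {M N : HilbertModule.{u} Ω} (x : prod M N) : ‖prodFst M N x‖ ≤ ‖x‖ :=
  WithLp.norm_fst_le (p := 2) (α := M) (β := N) x

/-- The closed submodule generated by a family of vectors. -/
def generated {H : HilbertModule.{u} Ω} {ι : Type v} (F : ι → H) : HilbertModule.{u} Ω :=
  H.ofSubmodule (Submodule.span (FunctionAlgebra Ω) (Set.range F)).topologicalClosure
    (Submodule.isClosed_topologicalClosure _)

/-- The generators of the closed submodule generated by a family of vectors. -/
def generator {H : HilbertModule.{u} Ω} {ι : Type v} (F : ι → H) (i : ι) : generated F :=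
  ⟨F i, Submodule.le_topologicalClosure _ (Submodule.subset_span ⟨i, rfl⟩)⟩

/-- The inclusion of the closed submodule generated by a family of vectors. -/
def generatedIncl {H : HilbertModule.{u} Ω} {ι : Type v} (F : ι → H) :
    generated F →L[FunctionAlgebra Ω] H :=
  subtypeA _ _ _

theorem generatedIncl_injective {H : HilbertModule.{u} Ω} {ι : Type v} (F : ι → H) :
    Function.Injective (generatedIncl F) := Subtype.val_injective

/-- The submodule has the induced topology, so closures in it are preimages of closures in `H`. -/
theorem generates_generator {H : HilbertModule.{u} Ω} {ι : Type v} (F : ι → H) :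
    Generates (generator F) := by
  have hmap : (Submodule.span (FunctionAlgebra Ω) (Set.range (generator F))).map
      (generatedIncl F).toLinearMap = Submodule.span (FunctionAlgebra Ω) (Set.range F) := by
    rw [Submodule.map_span, ← Set.range_comp]
    rfl
  intro x
  have hind : Topology.IsInducing (generatedIncl F) := Topology.IsInducing.subtypeVal
  have h : generatedIncl F '' (Submodule.span (FunctionAlgebra Ω) (Set.range (generator F)) :
      Set (generated F)) = Submodule.span (FunctionAlgebra Ω) (Set.range F) :=
    congrArg (fun S : Submodule (FunctionAlgebra Ω) H => (S : Set H)) hmap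
  rw [hind.closure_eq_preimage_closure_image, h]
  exact x.2

theorem Generates.induction {M : HilbertModule.{u} Ω} {ι : Type v} {f : ι → M} (hf : Generates f)
    {p : M → Prop} (closed : IsClosed {x | p x}) (zero : p 0)
    (add : ∀ x y, p x → p y → p (x + y))
    (smul : ∀ (φ : FunctionAlgebra Ω) i, p (φ • f i)) (x : M) : p x :=
  closed.closure_subset_iff.2 (span_range_induction zero add smul) (hf x)

theorem Generates.subsingleton {M : HilbertModule.{u} Ω} {ι : Type v} {f : ι → M}
    (hf : Generates f) [IsEmpty ι] : Subsingleton M :=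
  subsingleton_of_forall_eq 0 fun x =>
    hf.induction (p := fun x => x = 0) isClosed_singleton rfl
      (fun x y hx hy => by rw [hx, hy, add_zero]) (fun _ i => isEmptyElim i) x

/-- The kernel of a module map. -/
def kernel {M N : HilbertModule.{u} Ω} (X : M →L[FunctionAlgebra Ω] N) : HilbertModule.{u} Ω :=
  M.ofSubmodule X.ker X.isClosed_ker

/-- The inclusion of the kernel of a module map. -/
def kernelIncl {M N : HilbertModule.{u} Ω} (X : M →L[FunctionAlgebra Ω] N) :
    kernel X →L[FunctionAlgebra Ω] M :=
  subtypeA _ _ _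

theorem range_kernelIncl {M N : HilbertModule.{u} Ω} (X : M →L[FunctionAlgebra Ω] N) :
    Set.range (kernelIncl X) = {x | X x = 0} := Subtype.range_coe

theorem kernelIncl_injective {M N : HilbertModule.{u} Ω} (X : M →L[FunctionAlgebra Ω] N) :
    Function.Injective (kernelIncl X) := Subtype.val_injective

theorem IsEvalLinear.comp {M N : HilbertModule.{u} Ω} {E : Type*} [NormedAddCommGroup E]
    [NormedSpace ℂ E] {z : Ω} {T : N →L[ℂ] E} (hT : IsEvalLinear z T)
    (X : M →L[FunctionAlgebra Ω] N) : IsEvalLinear z (T ∘L X.restrictScalars ℂ) := by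
  intro φ f
  change T (X (φ • f)) = evalAt z φ • T (X f)
  rw [map_smul, hT]

theorem IsEvalLinear.lpMap {ι : Type u} {M : HilbertModule.{u} Ω} {z : Ω} {t : M →L[ℂ] ℂ}
    (ht : IsEvalLinear z t) : IsEvalLinear (M := l2Sum ι M) z (lpMap ι t) :=
  fun φ x => lp.ext (funext fun i => ht φ (l2SumEval i x))

/-- An orthonormal family `b` in `N` induces a bounded operator `ℓ²(ι, R) → N ⊗ R` that sends the
vector `r` in the coordinate `i` to `b i ⊗ r`. -/
theorem exists_l2_to_hilbertTensor {N : HilbertModule.{u} Ω} {ι : Type u} {b : ι → N}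
    (hb : Orthonormal ℂ b) (R : HilbertModule.{u} Ω) [DecidableEq ι] :
    ∃ J : lp (fun _ : ι => (R : Type u)) 2 →L[ℂ] HilbertTensor N R,
      ∀ i r, J (lp.single 2 i r) = ((b i ⊗ₜ[ℂ] r : N ⊗[ℂ] R) : HilbertTensor N R) := by
  let V (i : ι) : R →ₗᵢ[ℂ] HilbertTensor N R :=
    UniformSpace.Completion.toComplₗᵢ.comp
      { TensorProduct.mk ℂ N R (b i) with
        norm_map' := fun r => by
          change ‖b i ⊗ₜ[ℂ] r‖ = _
          rw [TensorProduct.norm_tmul, hb.1 i, one_mul] }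
  have hV : OrthogonalFamily ℂ (fun _ => (R : Type u)) V := by
    intro i j hij r s
    change inner ℂ ((b i ⊗ₜ[ℂ] r : N ⊗[ℂ] R) : HilbertTensor N R)
      ((b j ⊗ₜ[ℂ] s : N ⊗[ℂ] R) : HilbertTensor N R) = 0
    rw [UniformSpace.Completion.inner_coe, TensorProduct.inner_tmul, hb.2 hij, zero_mul]
  exact ⟨hV.linearIsometry.toContinuousLinearMap, fun i r => hV.linearIsometry_apply_single r⟩

end HilbertModule

/-! ### The quasi-free cover of a smooth module. -/

open HilbertModule

variable {m : ℕ} {Ω : Set (Fin m → ℂ)}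

/-- If some operators into `ℓ²(ι)` intertwining the action with the point evaluations send the
generators to the standard basis, are locally bounded and separate the vectors, then the module is
quasi-free. -/
theorem IsQuasiFree.of_coordinates {ι : Type u} [DecidableEq ι] [Nonempty ι]
    {P : HilbertModule.{u} Ω} {F : ι → P} (hF : Generates F) (T : Ω → P →L[ℂ] ℓ²(ι, ℂ))
    (hT : ∀ z, IsEvalLinear z (T z)) (hTF : ∀ z i, T z (F i) = lp.single 2 i (1 : ℂ))
    (hbdd : ∀ z₀, ∃ C : ℝ, ∀ᶠ z in nhds z₀, ‖T z‖ ≤ C)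
    (hsep : ∀ x, (∀ z, T z x = 0) → x = 0) : IsQuasiFree P F := by
  choose S hS hSn using fun z => exists_fiber_lift (hT z)
  have hSF (z : Ω) (i : ι) : S z (loc z (F i)) = lp.single 2 i (1 : ℂ) := by rw [hS, hTF]
  have hindep (z : Ω) : LinearIndependent ℂ fun i => loc z (F i) := by
    refine LinearIndependent.of_comp (S z).toLinearMap ?_
    have h : (S z).toLinearMap ∘ (fun i => loc z (F i)) =
        fun i : ι => (lp.single 2 i (1 : ℂ) : ℓ²(ι, ℂ)) := funext (hSF z)
    rw [h]
    refine Orthonormal.linearIndependent (𝕜 := ℂ) ⟨fun i => ?_, fun i j hij => ?_⟩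
    · rw [lp.norm_single (by norm_num), norm_one]
    · dsimp only
      rw [lp.inner_single_left, lp.single_apply_ne _ _ _ hij, inner_zero_right]
  refine ⟨inferInstance, hF, hindep, hF.dense_span_loc, fun z₀ => ?_, fun x => ⟨fun hx => ?_, ?_⟩⟩
  · obtain ⟨C, hC⟩ := hbdd z₀
    refine ⟨C, hC.mono fun z hz w => ?_⟩
    rw [coordMap_eq (hindep z) (S z).toLinearMap (fun i => (hSF z i).trans (by congr!))]
    exact (hSn z w).trans (mul_le_mul_of_nonneg_right hz (norm_nonneg _))
  · exact hsep x fun z => by rw [← hS, hx, map_zero]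
  · rintro rfl z
    exact (tmulACLM P (pointOne z)).map_zero

/-- A module that is smooth relative to a rank-one quasi-free module is densely covered by a
quasi-free module, with a kernel that is again smooth. -/
theorem IsSmooth.exists_cover {R : HilbertModule.{u} Ω} {g : R}
    (hR : IsQuasiFree R fun _ : Unit => g) {N : HilbertModule.{u} Ω} (hN : IsSmooth N R g) :
    ∃ (P : HilbertModule.{u} Ω) (X : P →L[FunctionAlgebra Ω] N) (ι : Type u) (F : ι → P),
      DenseRange X ∧ IsSmooth (kernel X) R g ∧ Generates F ∧ (Nonempty ι → IsQuasiFree P F) ∧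
      (Subsingleton N → IsEmpty ι) ∧ (TopologicalSpace.SeparableSpace N → Countable ι) := by
  classical
  obtain ⟨l, hl, hlg, hlb, hls⟩ := hR.exists_eval
  -- Orthonormality, which arbitrary generators lack, is what makes `J` bounded.
  obtain ⟨w, b, -⟩ := exists_hilbertBasis ℂ N
  obtain ⟨J, hJ⟩ := exists_l2_to_hilbertTensor b.orthonormal R
  let H := (l2Sum w R).prod N
  let F₀ (i : w) : H := WithLp.toLp 2 ((lp.single 2 i g : lp (fun _ : w => (R : Type u)) 2), b i)
  let P := generated F₀
  let F : w → P := generator F₀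
  have hF : Generates F := generates_generator F₀
  let Y : P →L[FunctionAlgebra Ω] l2Sum w R := (prodFst (l2Sum w R) N).comp (generatedIncl F₀)
  let X : P →L[FunctionAlgebra Ω] N := (prodSnd (l2Sum w R) N).comp (generatedIncl F₀)
  have hYF (i : w) : Y (F i) = (lp.single 2 i g : lp (fun _ : w => (R : Type u)) 2) := rfl
  have hXF (i : w) : X (F i) = b i := rfl
  have hYX (x : P) (h1 : Y x = 0) (h2 : X x = 0) : x = 0 :=
    generatedIncl_injective F₀ ((WithLp.ofLp_injective 2) (Prod.ext h1 h2))
  -- On `φ • F i` this reads `b i ⊗ φ g ≡ φ b i ⊗ g`; continuity gives the rest.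
  have hgraph (x : P) : (balancing N R).mkQL (J (Y x)) = tmulACLM N g (X x) := by
    refine hF.induction (p := fun x => (balancing N R).mkQL (J (Y x)) = tmulACLM N g (X x))
      ?_ ?_ ?_ ?_ x
    · exact isClosed_eq ((ContinuousLinearMap.continuous _).comp (J.continuous.comp Y.continuous))
        ((ContinuousLinearMap.continuous _).comp X.continuous)
    · rw [map_zero, map_zero, map_zero]
      exact (congrArg _ J.map_zero).trans (map_zero _)
    · intro x y hx hy
      rw [map_add, map_add, map_add, ← hx, ← hy, ← map_add]
      exact congrArg _ (J.map_add _ _)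
    · intro φ i
      have h : φ • (show l2Sum w R from lp.single 2 i g) = lp.single 2 i (φ • g) :=
        lpMap_single (R.smulCLM φ) i g
      rw [map_smul, map_smul, hYF, hXF, tmulACLM_apply, ← tmulA_smul]
      exact congrArg (balancing N R).mkQL ((congrArg J h).trans (hJ i (φ • g)))
  have hY (x : P) (h : Y x = 0) : x = 0 := by
    refine hYX x h (isSmooth_iff.1 hN _ ?_)
    rw [← tmulACLM_apply, ← hgraph, h]
    exact (congrArg _ J.map_zero).trans (map_zero _)
  have hsep (x : P) (h : ∀ z i, l z (l2SumEval i (Y x)) = 0) : x = 0 :=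
    hY x (lp.ext (funext fun i => hls _ fun z => h z i))
  refine ⟨P, X, w, F, ?_, ?_, hF, fun _ => ?_, fun _ => ?_, fun _ =>
    countable_of_orthonormal b.orthonormal⟩
  · have hle : Submodule.span ℂ (Set.range b) ≤ (X.restrictScalars ℂ).range :=
      Submodule.span_le.2 (Set.range_subset_iff.2 fun i => ⟨F i, hXF i⟩)
    have hd : Dense (Submodule.span ℂ (Set.range b) : Set N) :=
      Submodule.dense_iff_topologicalClosure_eq_top.2 b.dense_span
    exact hd.mono hle
  -- The functionals separating `P` restrict to the kernel and still separate it.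
  · refine isSmooth_of_separating (fun z => ⟨l z, hl z, hlg z⟩) fun x hx =>
      kernelIncl_injective X ((hsep _ fun z i => ?_).trans (map_zero _).symm)
    exact hx z _ ((hl z).comp ((l2SumEval i).comp (Y.comp (kernelIncl X))))
  · refine IsQuasiFree.of_coordinates hF
      (fun z => (lpMap w (l z) : l2Sum w R →L[ℂ] ℓ²(w, ℂ)) ∘L Y.restrictScalars ℂ)
      (fun z => (hl z).lpMap.comp Y) (fun z i => ?_) (fun z₀ => ?_) (fun x hx => ?_)
    · refine (lpMap_single (l z) i g).trans ?_
      rw [hlg]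
    · obtain ⟨C, hC⟩ := hlb z₀
      refine ⟨C, hC.mono fun z hz => ?_⟩
      refine ContinuousLinearMap.opNorm_le_bound _ ((norm_nonneg _).trans hz) fun x => ?_
      calc ‖lpMap w (l z) (Y x)‖ ≤ C * ‖Y x‖ :=
            (lpMap w (l z)).le_of_opNorm_le ((norm_lpMap_le _).trans hz) (Y x)
        _ ≤ C * ‖x‖ := by
          have h0 : 0 ≤ C := (norm_nonneg _).trans hz
          gcongr
          exact norm_prodFst_le (generatedIncl F₀ x)
    · exact hsep x fun z i => congrArg (fun y : ℓ²(w, ℂ) => y i) (hx z)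
  · refine ⟨fun i => ?_⟩
    have h := b.orthonormal.1 i
    rw [Subsingleton.elim (b i) 0, norm_zero] at h
    exact zero_ne_one h

end

/-! ### Separability and iteration of the cover. -/

section

open HilbertModule

variable {m : ℕ} {Ω : Set (Fin m → ℂ)}

/-- Functions holomorphic near the closure of `Ω` are restrictions of elements of `C(closure Ω, ℂ)`,
which is separable because the closure is compact. -/
theorem separableSpace_functionAlgebra (hΩ : Bornology.IsBounded Ω) :
    TopologicalSpace.SeparableSpace (FunctionAlgebra Ω) := by
  have : CompactSpace (closure Ω) := isCompact_iff_compactSpace.1 hΩ.isCompact_closure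
  let incl : C(Ω, closure Ω) := ⟨Set.inclusion subset_closure, continuous_inclusion subset_closure⟩
  let r : C(closure Ω, ℂ) → (Ω →ᵇ ℂ) := fun f =>
    (BoundedContinuousFunction.mkOfCompact f).compContinuous incl
  have hr : Continuous r :=
    (BoundedContinuousFunction.continuous_compContinuous incl).comp
      (ContinuousMap.isometryEquivBoundedOfCompact (closure Ω) ℂ).continuous
  have h1 : TopologicalSpace.IsSeparable (Set.range r) := TopologicalSpace.isSeparable_range hr
  have h2 : (holomorphicNearClosure Ω : Set (Ω →ᵇ ℂ)) ⊆ Set.range r := by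
    rintro f ⟨U, G, -, hU, hG, hf⟩
    exact ⟨⟨fun z => G z, continuousOn_iff_continuous_domRestrict.1 (hG.continuousOn.mono hU)⟩,
      BoundedContinuousFunction.ext fun z => (hf z).symm⟩
  exact ((h1.mono h2).closure).separableSpace

theorem HilbertModule.Generates.separableSpace [TopologicalSpace.SeparableSpace (FunctionAlgebra Ω)]
    {M : HilbertModule.{u} Ω} {ι : Type v} [Countable ι] {f : ι → M} (hf : Generates f) :
    TopologicalSpace.SeparableSpace M := by
  have h : TopologicalSpace.IsSeparable
      (Submodule.span (FunctionAlgebra Ω) (Set.range f) : Set M) :=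
    (Set.countable_range f).isSeparable.span
  exact TopologicalSpace.isSeparable_univ_iff.1 (hf.closure_eq ▸ h.closure)

/-- The modules that are smooth relative to `R` and `g`. -/
def SmoothModule (R : HilbertModule.{u} Ω) (g : R) : Type (u + 1) :=
  {N : HilbertModule.{u} Ω // IsSmooth N R g}

/-- Each cover has dense range in the kernel of the preceding one, which is weak exactness. An empty
basis makes its cover zero, then the next kernel and its basis, so the resolution stops there. -/
theorem exists_weakResolution {R : HilbertModule.{u} Ω} {g : R}
    (hR : IsQuasiFree R fun _ : Unit => g) {M : HilbertModule.{u} Ω} (hM : IsSmooth M R g) :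
    ∃ W : WeakResolution M,
      TopologicalSpace.SeparableSpace (FunctionAlgebra Ω) → TopologicalSpace.SeparableSpace M →
        ∀ n, (∃ k, k ≤ Cardinal.aleph0 ∧ IsQuasiFreeOfRank (W.R n) k) ∨
          ∀ l, n ≤ l → Subsingleton (W.R l) := by
  choose P X ι F hX hker hF hQF hsub hcount using
    fun N : SmoothModule R g => N.2.exists_cover hR
  let N : ℕ → SmoothModule R g := fun n => Nat.rec ⟨M, hM⟩ (fun _ N => ⟨kernel (X N), hker N⟩) n
  have hempty (n : ℕ) (h : IsEmpty (ι (N n))) : ∀ l, n ≤ l → IsEmpty (ι (N l)) := by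
    intro l hl
    induction l, hl using Nat.le_induction with
    | base => exact h
    | succ l hl ih =>
      have h1 : Subsingleton (P (N l)) := (hF (N l)).subsingleton
      exact hsub (N (l + 1)) ((kernelIncl_injective (X (N l))).subsingleton)
  have hsubsingleton (n : ℕ) (h : IsEmpty (ι (N n))) : ∀ l, n ≤ l → Subsingleton (P (N l)) := by
    intro l hl
    have := hempty n h l hl
    exact (hF (N l)).subsingleton
  have hexact (n : ℕ) : {x | X (N n) x = 0} =
      closure (Set.range ((kernelIncl (X (N n))).comp (X (N (n + 1))))) := by
    have hcl : IsClosed {x | X (N n) x = 0} := isClosed_eq (X (N n)).continuous continuous_const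
    rw [ContinuousLinearMap.coe_comp, Set.range_comp]
    refine Set.Subset.antisymm ?_ (hcl.closure_subset_iff.2 ?_)
    · rw [← range_kernelIncl, ← Set.image_univ, ← (hX (N (n + 1))).closure_eq]
      exact image_closure_subset_closure_image (kernelIncl (X (N n))).continuous
    · rw [← range_kernelIncl]
      exact Set.image_subset_range _ _
  have hexact' (n : ℕ) : {x | (kernelIncl (X (N n))).comp (X (N (n + 1))) x = 0} =
      {x | X (N (n + 1)) x = 0} := by
    ext x
    exact map_eq_zero_iff _ (kernelIncl_injective (X (N n)))
  refine ⟨⟨fun n => P (N n), X (N 0), fun n => (kernelIncl (X (N n))).comp (X (N (n + 1))),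
    hX (N 0), hexact 0, fun n => (hexact' n).trans (hexact (n + 1)), fun n => ?_⟩,
    fun hA hMs n => ?_⟩
  · rcases isEmpty_or_nonempty (ι (N n)) with h | h
    · exact Or.inr (hsubsingleton n h)
    · exact Or.inl ⟨_, ι (N n), F (N n), rfl, hQF (N n) h⟩
  -- A countable basis generates a separable cover, whose kernel is separable and so has a countable
  -- basis again.
  · have hc (n : ℕ) : Countable (ι (N n)) := by
      induction n with
      | zero => exact hcount (N 0) hMs
      | succ n ih =>
        have h1 : TopologicalSpace.SeparableSpace (P (N n)) := (hF (N n)).separableSpace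
        refine hcount (N (n + 1)) ?_
        exact (TopologicalSpace.IsSeparable.of_separableSpace
          ((X (N n)).ker : Set (P (N n)))).separableSpace
    rcases isEmpty_or_nonempty (ι (N n)) with h | h
    · exact Or.inr (hsubsingleton n h)
    · exact Or.inl ⟨_, Cardinal.mk_le_aleph0_iff.2 (hc n), ι (N n), F (N n), rfl, hQF (N n) h⟩

end

end QuasiFreeResolution

end

theorem theorem2 {m : ℕ} (Ω : Set (Fin m → ℂ)) (hΩ_open : IsOpen Ω) (hΩ_conn : IsConnected Ω)
    (hΩ_bdd : Bornology.IsBounded Ω)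
    (M : QuasiFreeResolution.HilbertModule Ω) (hM : QuasiFreeResolution.ClassSM M) :
    ∃ W : QuasiFreeResolution.WeakResolution M,
      M.CountablyGenerated → ∀ n,
        (∃ k, k ≤ Cardinal.aleph0 ∧ QuasiFreeResolution.IsQuasiFreeOfRank (W.R n) k) ∨
          ∀ l, n ≤ l → Subsingleton (W.R l) := by
  obtain ⟨R, g, hR, hMR⟩ := hM
  obtain ⟨W, hW⟩ := QuasiFreeResolution.exists_weakResolution hR hMR
  have hA := QuasiFreeResolution.separableSpace_functionAlgebra hΩ_bdd
  exact ⟨W, fun ⟨f, hf⟩ => hW hA hf.separableSpace⟩
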